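/- Work in $\mathbb R^n$ with Lebesgue measure. "Cube" means a cube of positive side length with sides parallel to the coordinate axes, and $|Q|$ is its volume. A weight is a measurable function $w:\mathbb R^n\to[0,\infty]$ with $0<w<\infty$ almost everywhere. For $1<q<\infty$, with $q'=q/(q-1)$, a weight $w$ belongs to $A_q$ if $$\sup_Q\Big(\frac1{|Q|}\int_Q w\,dx\Big)\Big(\frac1{|Q|}\int_Q w^{1-q'}\,dx\Big)^{q-1}<\infty,$$ where the supremum is over all cubes $Q$; and $A_\infty=\bigcup_{1<q<\infty}A_q$. Let $1<p_1,\ldots,p_m<\infty$ and $0<p<\infty$ be such that $\sum_{i=1}^m\frac1{p_i}=\frac1p$, and let $w_1,\ldots,w_m$ be weights with $w_i\in A_\infty$ for $1\le i\le m$. Then there is a finite constant $C$, independent of $Q$, such that for all cubes $Q$, $$\prod_{i=1}^m\Big(\frac1{|Q|}\int_Q w_i\,dx\Big)^{\frac p{p_i}}\le C\,\frac1{|Q|}\int_Q\prod_{i=1}^m w_i^{\frac p{p_i}}\,dx .$$ -/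

import Mathlib

open MeasureTheory
open scoped NNReal ENNReal

noncomputable section

/-- `Q` is a (nondegenerate) cube in `ℝⁿ` with sides parallel to the coordinate axes:
`Q = ∏ⱼ [aⱼ, aⱼ + ℓ]` with side length `ℓ > 0`. -/
def IsCube {n : ℕ} (Q : Set (Fin n → ℝ)) : Prop :=
  ∃ (a : Fin n → ℝ) (l : ℝ), 0 < l ∧ Q = Set.Icc a (fun j => a j + l)

/-- A weight on `ℝⁿ`: a Lebesgue measurable function with values in `[0, ∞]` that is positive and
finite almost everywhere. -/
def IsWeight {n : ℕ} (w : (Fin n → ℝ) → ℝ≥0∞) : Prop :=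
  AEMeasurable w volume ∧ ∀ᵐ x ∂volume, 0 < w x ∧ w x < ∞

/-- The Muckenhoupt constant
`[w]_{A_p} = sup_Q (⨍_Q w dx) (⨍_Q w ^ (1 - p') dx) ^ (p - 1)`, where `p' = p / (p - 1)` and the
supremum is over all cubes with sides parallel to the coordinate axes. -/
def muckenhouptConst {n : ℕ} (p : ℝ) (w : (Fin n → ℝ) → ℝ≥0∞) : ℝ≥0∞ :=
  ⨆ (Q : Set (Fin n → ℝ)) (_ : IsCube Q),
    (⨍⁻ x in Q, w x ∂volume) * (⨍⁻ x in Q, w x ^ (1 - p.conjExponent) ∂volume) ^ (p - 1)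

/-- The Muckenhoupt class `A_p` (used for `1 < p < ∞`). Since a weight is finite a.e., the second
average in the constant is never zero, so membership forces `w` to be locally integrable. -/
def MemMuckenhoupt {n : ℕ} (p : ℝ) (w : (Fin n → ℝ) → ℝ≥0∞) : Prop :=
  IsWeight w ∧ muckenhouptConst p w < ∞

/-- The class `A_∞ = ⋃_{1 < p < ∞} A_p`. -/
def MemAInfty {n : ℕ} (w : (Fin n → ℝ) → ℝ≥0∞) : Prop :=
  ∃ p : ℝ, 1 < p ∧ MemMuckenhoupt p w

end

/-! Choose `q i` with `w i` in $A_{q_i}$ and put $\theta_i=p/p_i$, $\sigma_i=w_i^{1-q_i'}$. As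
$(1-q_i')(q_i-1)=-1$, a.e. $\prod_i w_i^{\theta_i}\cdot\prod_i\sigma_i^{(q_i-1)\theta_i}=1$. Hölder
on $Q$ with normalised measure then bounds the average of the first factor times the
$\sigma_i$-averages to these powers below by 1. Multiplying by $\prod_i(\text{average of
}w_i)^{\theta_i}$ and pairing each $w_i$ with $\sigma_i$ gives
$C=\prod_i[w_i]_{A_{q_i}}^{\theta_i}$; no reverse Hölder inequality is needed. -/

open Finset in
/-- If `f * ∏ i, v i ^ b i` is at least one almost everywhere on a probability space, then Hölder's
inequality bounds the product of the corresponding integrals from below by one. -/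
theorem one_le_lintegral_mul_prod_rpow {α ι : Type*} [MeasurableSpace α] [Fintype ι]
    {μ : Measure α} [IsProbabilityMeasure μ] {f : α → ℝ≥0∞} {v : ι → α → ℝ≥0∞} {b : ι → ℝ}
    (hf : AEMeasurable f μ) (hv : ∀ i, AEMeasurable (v i) μ) (hb : ∀ i, 0 ≤ b i)
    (h : ∀ᵐ x ∂μ, 1 ≤ f x * ∏ i, v i x ^ b i) :
    1 ≤ (∫⁻ x, f x ∂μ) * ∏ i, (∫⁻ x, v i x ∂μ) ^ b i := by
  have hB : 0 ≤ ∑ i, b i := sum_nonneg fun i _ => hb i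
  -- The factor `a` scales the exponents `1, b i` to total 1, so Hölder applies to the `a`-th power
  -- of the product, still at least 1.
  set a : ℝ := (1 + ∑ i, b i)⁻¹ with ha
  have ha0 : 0 < a := by positivity
  have hsum : a + ∑ i, a * b i = 1 := by
    rw [← mul_sum, ha]
    field_simp
  have key := ENNReal.lintegral_mul_prod_norm_pow_le univ hf (fun i _ => hv i) a hsum ha0.le
    (fun i _ => mul_nonneg ha0.le (hb i))
  have pull : ∀ (s : ℝ≥0∞) (t : ι → ℝ≥0∞),
      s ^ a * ∏ i, t i ^ (a * b i) = (s * ∏ i, t i ^ b i) ^ a := fun s t => by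
    rw [ENNReal.mul_rpow_of_nonneg _ _ ha0.le, ← ENNReal.prod_rpow_of_nonneg ha0.le]
    simp_rw [← ENNReal.rpow_mul, mul_comm (b _) a]
  simp_rw [pull] at key
  rw [← ENNReal.rpow_le_rpow_iff ha0, ENNReal.one_rpow]
  refine le_trans ?_ key
  calc (1 : ℝ≥0∞) = ∫⁻ _, 1 ∂μ := by simp
    _ ≤ _ := lintegral_mono_ae (h.mono fun x hx => ENNReal.one_le_rpow hx ha0)

theorem IsCube.volume_ne_zero {n : ℕ} {Q : Set (Fin n → ℝ)} (hQ : IsCube Q) : volume Q ≠ 0 := by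
  obtain ⟨a, l, hl, rfl⟩ := hQ
  simp [Real.volume_Icc_pi, hl]

theorem IsCube.volume_ne_top {n : ℕ} {Q : Set (Fin n → ℝ)} (hQ : IsCube Q) : volume Q ≠ ∞ := by
  obtain ⟨a, l, -, rfl⟩ := hQ
  exact isCompact_Icc.measure_ne_top

theorem laverage_mul_le_muckenhouptConst {n : ℕ} (p : ℝ) (w : (Fin n → ℝ) → ℝ≥0∞)
    {Q : Set (Fin n → ℝ)} (hQ : IsCube Q) :
    (⨍⁻ x in Q, w x ∂volume) * (⨍⁻ x in Q, w x ^ (1 - p.conjExponent) ∂volume) ^ (p - 1) ≤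
      muckenhouptConst p w :=
  le_iSup₂ (f := fun (Q : Set (Fin n → ℝ)) (_ : IsCube Q) =>
    (⨍⁻ x in Q, w x ∂volume) * (⨍⁻ x in Q, w x ^ (1 - p.conjExponent) ∂volume) ^ (p - 1)) Q hQ

theorem mainTheorem3 {n m : ℕ} (pv : Fin m → ℝ) (p : ℝ)
    (hpv : ∀ i, 1 < pv i) (hp : 0 < p) (hsum : ∑ i, 1 / pv i = 1 / p)
    (w : Fin m → (Fin n → ℝ) → ℝ≥0∞) (hw : ∀ i, MemAInfty (w i)) :
    ∃ C : ℝ≥0, ∀ Q : Set (Fin n → ℝ), IsCube Q →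
      ∏ i, (⨍⁻ x in Q, w i x ∂volume) ^ (p / pv i) ≤
        C * ⨍⁻ x in Q, ∏ i, w i x ^ (p / pv i) ∂volume := by
  choose q hq hwq using hw
  have hθ : ∀ i, 0 ≤ p / pv i := fun i => (div_pos hp (one_pos.trans (hpv i))).le
  have hK : ∏ i, muckenhouptConst (q i) (w i) ^ (p / pv i) ≠ ∞ :=
    ENNReal.prod_ne_top fun i _ => ENNReal.rpow_ne_top_of_nonneg (hθ i) (hwq i).2.ne
  refine ⟨(∏ i, muckenhouptConst (q i) (w i) ^ (p / pv i)).toNNReal, fun Q hQ => ?_⟩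
  rw [ENNReal.coe_toNNReal hK]
  set S : Fin m → ℝ≥0∞ := fun i => ⨍⁻ x in Q, w i x ^ (1 - (q i).conjExponent) ∂volume with hS
  set F : ℝ≥0∞ := ⨍⁻ x in Q, ∏ i, w i x ^ (p / pv i) ∂volume with hF
  have hone : 1 ≤ F * ∏ i, S i ^ ((q i - 1) * (p / pv i)) := by
    have : NeZero (volume.restrict Q) :=
      ⟨by simpa [Measure.restrict_eq_zero] using hQ.volume_ne_zero⟩
    have : IsFiniteMeasure (volume.restrict Q) :=
      isFiniteMeasure_restrict.2 hQ.volume_ne_top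
    -- Averages over `Q` become integrals against a probability measure.
    simp only [hF, hS, laverage]
    have hac : (volume.restrict Q Set.univ)⁻¹ • volume.restrict Q ≪ volume :=
      (Measure.smul_absolutelyContinuous).trans Measure.restrict_le_self.absolutelyContinuous
    have hm : ∀ i, AEMeasurable (w i) ((volume.restrict Q Set.univ)⁻¹ • volume.restrict Q) :=
      fun i => (hwq i).1.1.mono_ac hac
    refine one_le_lintegral_mul_prod_rpow
      (Finset.aemeasurable_fun_prod _ fun i _ => (hm i).pow_const _)
      (fun i => (hm i).pow_const _)
      (fun i => mul_nonneg (sub_nonneg.2 (hq i).le) (hθ i)) ?_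
    filter_upwards [ae_all_iff.2 fun i => hac.ae_le (hwq i).1.2] with x hx
    rw [← Finset.prod_mul_distrib]
    refine (Finset.prod_eq_one fun i _ => ?_).ge
    have hq1 : q i - 1 ≠ 0 := (sub_pos.2 (hq i)).ne'
    rw [← ENNReal.rpow_mul, ← ENNReal.rpow_add _ _ (hx i).1.ne' (hx i).2.ne]
    have : p / pv i + (1 - (q i).conjExponent) * ((q i - 1) * (p / pv i)) = 0 := by
      rw [Real.conjExponent]
      field_simp
      ring
    rw [this, ENNReal.rpow_zero]
  calc ∏ i, (⨍⁻ x in Q, w i x ∂volume) ^ (p / pv i)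
      ≤ (∏ i, (⨍⁻ x in Q, w i x ∂volume) ^ (p / pv i)) *
          (F * ∏ i, S i ^ ((q i - 1) * (p / pv i))) := le_mul_of_one_le_right' hone
    _ = (∏ i, ((⨍⁻ x in Q, w i x ∂volume) * S i ^ (q i - 1)) ^ (p / pv i)) * F := by
      simp_rw [ENNReal.mul_rpow_of_nonneg _ _ (hθ _), Finset.prod_mul_distrib, ENNReal.rpow_mul]
      ring
    _ ≤ (∏ i, muckenhouptConst (q i) (w i) ^ (p / pv i)) * F := by
      gcongr with i
      · exact hθ i
      · exact laverage_mul_le_muckenhouptConst (q i) (w i) hQ
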